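/- Let $n\ge 0$ be an integer and let $B_n$ be the braid group on $n$ strands, with standard generators $\sigma_1,\dots,\sigma_{n-1}$ and relations $\sigma_i\sigma_j=\sigma_j\sigma_i$ for $|i-j|\ge 2$ and $\sigma_i\sigma_{i+1}\sigma_i=\sigma_{i+1}\sigma_i\sigma_{i+1}$ for $1\le i\le n-2$ (so $B_0$ and $B_1$ are trivial). Let $H$ be any group and let $h\in H$ with $h\neq 1$. Let $G=H_1*\cdots*H_n$ be the free product of $n$ copies of $H$, let $\phi_i\colon H\to H_i\subset G$ be the natural isomorphism onto the $i$-th factor, and put $h_i=\phi_i(h)$. For $1\le k\le n-1$ let $\tau_k$ be the automorphism of $G$ determined, for $y\in H$, by $$\tau_k(\phi_k(y))=h_k^{-1}\,\phi_{k+1}(y)\,h_k,\qquad \tau_k(\phi_{k+1}(y))=h_k\,\phi_k(y)\,h_k^{-1},\qquad \tau_k(\phi_j(y))=\phi_j(y)\ \text{ for } j\ne k,k+1.$$ The assignment $\sigma_k\mapsto\tau_k$ determines a homomorphism $\rho\colon B_n\to\mathrm{Aut}(G)$, where the product in $\mathrm{Aut}(G)$ is composition of maps, called the Artin type representation of $B_n$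 associated to $(H,h)$. **Proposition.** The representation $\rho$ is faithful, that is, the homomorphism $\rho\colon B_n\to\mathrm{Aut}(G)$ is injective. -/

import Mathlib

/-- The defining relators of the braid group on `n` strands, with generators `σ_k` indexed by
`k : Fin (n - 1)` (zero-based): `σ_i σ_j = σ_j σ_i` for `|i - j| ≥ 2` and
`σ_i σ_{i+1} σ_i = σ_{i+1} σ_i σ_{i+1}`. -/
def braidRelators (n : ℕ) : Set (FreeGroup (Fin (n - 1))) :=
  {r | ∃ i j : Fin (n - 1), (i : ℕ) + 2 ≤ (j : ℕ) ∧
      r = FreeGroup.of i * FreeGroup.of j * (FreeGroup.of j * FreeGroup.of i)⁻¹} ∪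
  {r | ∃ i j : Fin (n - 1), (i : ℕ) + 1 = (j : ℕ) ∧
      r = FreeGroup.of i * FreeGroup.of j * FreeGroup.of i *
        (FreeGroup.of j * FreeGroup.of i * FreeGroup.of j)⁻¹}

/-- The braid group on `n` strands, by Artin's presentation. It is trivial for `n = 0, 1`. -/
abbrev BraidGroup (n : ℕ) : Type := PresentedGroup (braidRelators n)

/-- The standard generator `σ_k` of the braid group. -/
def BraidGroup.σ {n : ℕ} (k : Fin (n - 1)) : BraidGroup n := PresentedGroup.of k

/-- The free product `H_1 ∗ ⋯ ∗ H_n` of `n` copies of the group `H`. -/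
abbrev FreePower (n : ℕ) (H : Type*) [Group H] := Monoid.CoprodI (fun _ : Fin n => H)

namespace ArtinType

variable {n : ℕ} {H : Type*} [Group H]

/-- The inclusion `φ_i` of `H` onto the `i`-th free factor. -/
def φ (i : Fin n) : H →* FreePower n H := Monoid.CoprodI.of (M := fun _ : Fin n => H) (i := i)

/-- The strand `k` at which the generator `σ_k` acts. -/
def lo (k : Fin (n - 1)) : Fin n := ⟨k, by omega⟩

/-- The strand `k + 1` at which the generator `σ_k` acts. -/
def hi (k : Fin (n - 1)) : Fin n := ⟨k + 1, by omega⟩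

lemma lo_ne_hi (k : Fin (n - 1)) : lo k ≠ hi k := by simp [lo, hi]

/-- The endomorphism of `H_1 ∗ ⋯ ∗ H_n` with `φ_k(y) ↦ h_k⁻¹ φ_{k+1}(y) h_k`,
`φ_{k+1}(y) ↦ h_k φ_k(y) h_k⁻¹`, and `φ_j(y) ↦ φ_j(y)` for `j ≠ k, k+1`, where `h_k = φ_k(h)`. -/
def tauHom (h : H) (k : Fin (n - 1)) : FreePower n H →* FreePower n H :=
  Monoid.CoprodI.lift fun j =>
    if j = lo k then (MulAut.conj (φ (lo k) h)⁻¹).toMonoidHom.comp (φ (hi k))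
    else if j = hi k then (MulAut.conj (φ (lo k) h)).toMonoidHom.comp (φ (lo k))
    else φ j

/-- The inverse of `tauHom h k`. -/
def tauInvHom (h : H) (k : Fin (n - 1)) : FreePower n H →* FreePower n H :=
  Monoid.CoprodI.lift fun j =>
    if j = lo k then (MulAut.conj (φ (hi k) h)⁻¹).toMonoidHom.comp (φ (hi k))
    else if j = hi k then (MulAut.conj (φ (hi k) h)).toMonoidHom.comp (φ (lo k))
    else φ j

lemma tauHom_lo (h : H) (k : Fin (n - 1)) (y : H) :
    tauHom h k (φ (lo k) y) = (φ (lo k) h)⁻¹ * φ (hi k) y * φ (lo k) h := by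
  unfold tauHom
  conv_lhs => arg 2; unfold φ
  rw [Monoid.CoprodI.lift_of]
  simp

lemma tauHom_hi (h : H) (k : Fin (n - 1)) (y : H) :
    tauHom h k (φ (hi k) y) = φ (lo k) h * φ (lo k) y * (φ (lo k) h)⁻¹ := by
  unfold tauHom
  conv_lhs => arg 2; unfold φ
  rw [Monoid.CoprodI.lift_of]
  simp [(lo_ne_hi k).symm]

lemma tauHom_of_ne (h : H) (k : Fin (n - 1)) {j : Fin n} (h₁ : j ≠ lo k) (h₂ : j ≠ hi k) (y : H) :
    tauHom h k (φ j y) = φ j y := by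
  unfold tauHom
  conv_lhs => arg 2; unfold φ
  rw [Monoid.CoprodI.lift_of]
  simp [h₁, h₂]

lemma tauInvHom_lo (h : H) (k : Fin (n - 1)) (y : H) :
    tauInvHom h k (φ (lo k) y) = (φ (hi k) h)⁻¹ * φ (hi k) y * φ (hi k) h := by
  unfold tauInvHom
  conv_lhs => arg 2; unfold φ
  rw [Monoid.CoprodI.lift_of]
  simp

lemma tauInvHom_hi (h : H) (k : Fin (n - 1)) (y : H) :
    tauInvHom h k (φ (hi k) y) = φ (hi k) h * φ (lo k) y * (φ (hi k) h)⁻¹ := by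
  unfold tauInvHom
  conv_lhs => arg 2; unfold φ
  rw [Monoid.CoprodI.lift_of]
  simp [(lo_ne_hi k).symm]

lemma tauInvHom_of_ne (h : H) (k : Fin (n - 1)) {j : Fin n} (h₁ : j ≠ lo k) (h₂ : j ≠ hi k)
    (y : H) : tauInvHom h k (φ j y) = φ j y := by
  unfold tauInvHom
  conv_lhs => arg 2; unfold φ
  rw [Monoid.CoprodI.lift_of]
  simp [h₁, h₂]

/-- Endomorphisms of the free product that agree on all the factors are equal. -/
lemma hom_ext {f g : FreePower n H →* FreePower n H} (e : ∀ j y, f (φ j y) = g (φ j y)) :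
    f = g :=
  Monoid.CoprodI.ext_hom _ _ fun j => MonoidHom.ext fun y => e j y

lemma tauInv_comp_tau (h : H) (k : Fin (n - 1)) :
    (tauInvHom h k).comp (tauHom h k) = MonoidHom.id _ := by
  refine hom_ext fun j y => ?_
  by_cases h₁ : j = lo k
  · subst h₁
    simp only [MonoidHom.comp_apply, MonoidHom.id_apply, tauHom_lo, map_mul, map_inv,
      tauInvHom_lo, tauInvHom_hi]
    group
  by_cases h₂ : j = hi k
  · subst h₂
    simp only [MonoidHom.comp_apply, MonoidHom.id_apply, tauHom_hi, map_mul, map_inv,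
      tauInvHom_lo]
    group
  · simp [tauHom_of_ne, tauInvHom_of_ne, h₁, h₂]

lemma tau_comp_tauInv (h : H) (k : Fin (n - 1)) :
    (tauHom h k).comp (tauInvHom h k) = MonoidHom.id _ := by
  refine hom_ext fun j y => ?_
  by_cases h₁ : j = lo k
  · subst h₁
    simp only [MonoidHom.comp_apply, MonoidHom.id_apply, tauInvHom_lo, map_mul, map_inv,
      tauHom_hi]
    group
  by_cases h₂ : j = hi k
  · subst h₂
    simp only [MonoidHom.comp_apply, MonoidHom.id_apply, tauInvHom_hi, map_mul, map_inv,
      tauHom_lo, tauHom_hi]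
    group
  · simp [tauHom_of_ne, tauInvHom_of_ne, h₁, h₂]

/-- The automorphism `τ_k` of `H_1 ∗ ⋯ ∗ H_n` determined by `h`. -/
def tau (h : H) (k : Fin (n - 1)) : MulAut (FreePower n H) :=
  MonoidHom.toMulEquiv (tauHom h k) (tauInvHom h k) (tauInv_comp_tau h k) (tau_comp_tauInv h k)

lemma tau_apply (h : H) (k : Fin (n - 1)) (g : FreePower n H) : tau h k g = tauHom h k g := rfl

lemma tau_ext {f g : MulAut (FreePower n H)} (e : ∀ j y, f (φ j y) = g (φ j y)) : f = g := by
  have := hom_ext (f := f.toMonoidHom) (g := g.toMonoidHom) e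
  ext x
  exact DFunLike.congr_fun this x

lemma tau_comm (h : H) {i j : Fin (n - 1)} (hij : (i : ℕ) + 2 ≤ (j : ℕ)) :
    tau h i * tau h j = tau h j * tau h i := by
  have a₁ : lo i ≠ lo j := by simp only [lo, ne_eq, Fin.mk.injEq]; omega
  have a₂ : lo i ≠ hi j := by simp only [lo, hi, ne_eq, Fin.mk.injEq]; omega
  have a₃ : hi i ≠ lo j := by simp only [lo, hi, ne_eq, Fin.mk.injEq]; omega
  have a₄ : hi i ≠ hi j := by simp only [hi, ne_eq, Fin.mk.injEq]; omega
  refine tau_ext fun l y => ?_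
  simp only [MulAut.mul_apply, tau_apply]
  by_cases b₁ : l = lo i
  · subst b₁
    simp [tauHom_lo, tauHom_of_ne, a₁, a₂, a₃, a₄]
  by_cases b₂ : l = hi i
  · subst b₂
    simp [tauHom_hi, tauHom_of_ne, a₁, a₂, a₃, a₄]
  by_cases b₃ : l = lo j
  · subst b₃
    simp [tauHom_lo, tauHom_of_ne, a₁.symm, a₂.symm, a₃.symm, a₄.symm]
  by_cases b₄ : l = hi j
  · subst b₄
    simp [tauHom_hi, tauHom_of_ne, a₁.symm, a₂.symm, a₃.symm, a₄.symm]
  simp [tauHom_of_ne, b₁, b₂, b₃, b₄]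

lemma tau_braid (h : H) {i j : Fin (n - 1)} (hij : (i : ℕ) + 1 = (j : ℕ)) :
    tau h i * tau h j * tau h i = tau h j * tau h i * tau h j := by
  have e : hi i = lo j := by simp only [lo, hi, Fin.mk.injEq]; omega
  have a₁ : lo i ≠ lo j := by simp only [lo, ne_eq, Fin.mk.injEq]; omega
  have a₂ : lo i ≠ hi j := by simp only [lo, hi, ne_eq, Fin.mk.injEq]; omega
  have a₃ := lo_ne_hi j
  have t₁ : ∀ y, tauHom h i (φ (lo j) y) = φ (lo i) h * φ (lo i) y * (φ (lo i) h)⁻¹ := by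
    intro y; rw [← e]; exact tauHom_hi h i y
  have t₂ : ∀ y, tauHom h i (φ (lo i) y) = (φ (lo i) h)⁻¹ * φ (lo j) y * φ (lo i) h := by
    intro y; rw [← e]; exact tauHom_lo h i y
  have t₃ : ∀ y, tauHom h i (φ (hi j) y) = φ (hi j) y := fun y =>
    tauHom_of_ne h i a₂.symm (by rw [e]; exact a₃.symm) y
  have t₄ : ∀ y, tauHom h j (φ (lo i) y) = φ (lo i) y := fun y => tauHom_of_ne h j a₁ a₂ y
  refine tau_ext fun l y => ?_
  simp only [MulAut.mul_apply, tau_apply]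
  by_cases b₁ : l = lo i
  · subst b₁
    simp only [t₁, t₂, t₃, t₄, tauHom_lo, map_mul, map_inv]
    group
  by_cases b₂ : l = lo j
  · subst b₂
    simp only [t₁, t₂, t₃, t₄, tauHom_lo, tauHom_hi, map_mul, map_inv]
    group
  by_cases b₃ : l = hi j
  · subst b₃
    simp only [t₁, t₃, t₄, tauHom_hi, map_mul, map_inv]
  have b₄ : l ≠ hi i := by rw [e]; exact b₂
  simp [tauHom_of_ne, b₁, b₂, b₃, b₄]

lemma tau_relators (h : H) : ∀ r ∈ braidRelators n, FreeGroup.lift (tau h) r = 1 := by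
  rintro r (⟨i, j, hij, rfl⟩ | ⟨i, j, hij, rfl⟩)
  · simp only [map_mul, map_inv, FreeGroup.lift_apply_of]
    exact mul_inv_eq_one.2 (tau_comm h hij)
  · simp only [map_mul, map_inv, FreeGroup.lift_apply_of]
    exact mul_inv_eq_one.2 (tau_braid h hij)

end ArtinType

/-- The Artin type representation `ρ : B_n → Aut(H_1 ∗ ⋯ ∗ H_n)`, `σ_k ↦ τ_k`, associated to the
pair `(H, h)`. The product in `MulAut` is composition of maps. -/
def artinTypeRep (n : ℕ) {H : Type*} [Group H] (h : H) :
    BraidGroup n →* MulAut (FreePower n H) :=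
  PresentedGroup.toGroup (ArtinType.tau_relators h)

/-- The representation sends the standard generator `σ_k` to `τ_k`. -/
lemma artinTypeRep_σ {n : ℕ} {H : Type*} [Group H] (h : H) (k : Fin (n - 1)) :
    artinTypeRep n h (BraidGroup.σ k) = ArtinType.tau h k :=
  PresentedGroup.toGroup.of _

/-! By induction on the number of strands, a stronger claim holds: a braid that fixes every `h_j` is
trivial (`eq_one_of_fixes`). On `N + 2` strands, numbered from `0` to `N + 1`, the braid relations
alone write every braid as `f * b * t_j`, where `f` is a product of pushes `a_k^{±1}` of the last
strand around strand `k`, `b` is a braid on the other strands, and `t_j = σ_N ⋯ σ_j`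
(`exists_decomposition`).

Suppose such a product fixes all copies of `h`. Both `f` and `b` send `h_{N+1}` to a conjugate,
while `t_j` with `j ≤ N` sends it to `h_N`; killing the last factor separates these classes, so
`t_j` is absent. After the last factor is killed, `f` acts trivially on the copies of `h` and `b`
acts as a braid on one strand less, so `b = 1` by induction.

There remains `f`, which fixes `z = h_{N+1}`. A ping-pong argument shows that a reduced word in the
`a_k` beginning with a power of `a_k` sends `z` to `u⁻¹ z u`, where the normal form of `u` begins in
factor `k` (`pushHom_apply_last`). Such a `u` does not commute with `z`, so the word is empty. The
argument works because `a_k^m` conjugates by powers of `z h_k` and `h_k z`, alternating words that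
cannot cancel against an element beginning in a third factor. Only `h ≠ 1` matters; `h` may have
finite order. -/

namespace Monoid.CoprodI

/-! ### Normal forms in free products -/

variable {ι : Type*} {G : ι → Type*} [∀ i, Group (G i)]

open Classical in
/-- The index of the first syllable of the normal form of an element of a free product. -/
noncomputable def fstIndex (g : CoprodI G) : Option ι := (Word.equiv g).fstIdx

lemma fstIndex_prod (w : Word G) : fstIndex w.prod = w.fstIdx := by
  classical
  have : Word.equiv w.prod = w := Word.equiv.apply_symm_apply _
  unfold fstIndex
  convert congrArg Word.fstIdx this

lemma fstIndex_one : fstIndex (1 : CoprodI G) = none := by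
  rw [← Word.prod_empty, fstIndex_prod]
  rfl

lemma fstIndex_of_mul {i : ι} {y : G i} (hy : y ≠ 1) {g : CoprodI G}
    (hg : fstIndex g ≠ some i) : fstIndex (of y * g) = some i := by
  classical
  obtain ⟨w, rfl⟩ : ∃ w : Word G, w.prod = g := ⟨_, Word.equiv.symm_apply_apply g⟩
  rw [fstIndex_prod] at hg
  rw [← Word.prod_cons i y w hy hg, fstIndex_prod, Word.fstIdx_cons]

/-- Induction along normal forms. -/
lemma normal_induction {p : CoprodI G → Prop} (one : p 1)
    (cons : ∀ (i : ι) (y : G i) (g : CoprodI G), y ≠ 1 → fstIndex g ≠ some i → p g →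
      p (of y * g)) (g : CoprodI G) : p g := by
  classical
  obtain ⟨w, rfl⟩ : ∃ w : Word G, w.prod = g := ⟨_, Word.equiv.symm_apply_apply g⟩
  induction w using Word.consRecOn with
  | empty => simpa using one
  | cons i m w h1 h2 ih =>
    rw [Word.prod_cons]
    exact cons i m _ h2 (by rwa [fstIndex_prod]) ih

/-- The subgroup of a free product generated by the factors whose index lies in `S`. -/
def factors (G : ι → Type*) [∀ i, Group (G i)] (S : Set ι) : Subgroup (CoprodI G) :=
  Subgroup.closure {x | ∃ i ∈ S, ∃ y : G i, x = of y}

lemma of_mem_factors {S : Set ι} {i : ι} (hi : i ∈ S) (y : G i) : of y ∈ factors G S :=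
  Subgroup.subset_closure ⟨i, hi, y, rfl⟩

/-- Elements all of whose syllables have index in `S`. -/
inductive SyllablesIn (S : Set ι) : CoprodI G → Prop
  | one : SyllablesIn S 1
  | cons (i : ι) (y : G i) (g : CoprodI G) : i ∈ S → y ≠ 1 → fstIndex g ≠ some i →
      SyllablesIn S g → SyllablesIn S (of y * g)

lemma SyllablesIn.of_mul {S : Set ι} {g : CoprodI G} (hg : SyllablesIn S g) {i : ι} (hi : i ∈ S)
    (y : G i) : SyllablesIn S (of y * g) := by
  by_cases hy : y = 1
  · simpa [hy] using hg
  cases hg with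
  | one => exact .cons i y 1 hi hy (by simp [fstIndex_one]) .one
  | cons j y' g hj hy' hg' hg =>
    by_cases hij : j = i
    · subst hij
      rw [← mul_assoc, ← map_mul]
      by_cases h1 : y * y' = 1
      · simpa [h1] using hg
      · exact .cons j _ g hj h1 hg' hg
    · exact .cons i y _ hi hy (by rw [fstIndex_of_mul hy' hg']; simpa using hij)
        (.cons j y' g hj hy' hg' hg)

/-- Passing from generators to normal forms allows induction along reduced words that stay inside
`S`. -/
lemma syllablesIn_of_mem_factors {S : Set ι} {d : CoprodI G} (hd : d ∈ factors G S) :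
    SyllablesIn S d := by
  induction hd using Subgroup.closure_induction_left with
  | one => exact .one
  | mul_left x hx y hy ih =>
    obtain ⟨i, hi, y, rfl⟩ := hx
    exact ih.of_mul hi y
  | inv_mul_cancel x hx y hy ih =>
    obtain ⟨i, hi, y, rfl⟩ := hx
    rw [← map_inv]
    exact ih.of_mul hi _

/-- The last syllable of `d` has index in `S` and the first syllable of `g` does not, so nothing
cancels at the junction. -/
lemma SyllablesIn.fstIndex_mul {S : Set ι} {d : CoprodI G} (hd : SyllablesIn S d) {g : CoprodI G}
    (hg : ∀ i ∈ S, fstIndex g ≠ some i) :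
    d = 1 ∨ ∃ i ∈ S, fstIndex d = some i ∧ fstIndex (d * g) = some i := by
  induction hd with
  | one => exact .inl rfl
  | cons i y d hi hy hid _ ih =>
    refine .inr ⟨i, hi, fstIndex_of_mul hy hid, ?_⟩
    rw [mul_assoc]
    refine fstIndex_of_mul hy ?_
    rcases ih with rfl | ⟨j, _, hj, hj'⟩
    · simpa using hg i hi
    · rwa [hj', ← hj]

lemma fstIndex_mul_of_mem_factors {S : Set ι} {d : CoprodI G} (hd : d ∈ factors G S) (h1 : d ≠ 1)
    {g : CoprodI G} (hg : ∀ i ∈ S, fstIndex g ≠ some i) : ∃ i ∈ S, fstIndex (d * g) = some i := by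
  obtain ⟨i, hi, -, h⟩ := ((syllablesIn_of_mem_factors hd).fstIndex_mul hg).resolve_left h1
  exact ⟨i, hi, h⟩

/-- Right multiplication by an element of a factor does not change the first syllable index, unless
it gives `1`. -/
lemma fstIndex_mul_of (g : CoprodI G) {n : ι} (y : G n) :
    g = 1 ∨ fstIndex (g * of y) = fstIndex g ∨ (fstIndex g = some n ∧ g * of y = 1) := by
  have hof : ∀ {i}, i ≠ n → fstIndex (of y) ≠ some i := by
    intro i hi
    by_cases hy : y = 1
    · simp [hy, fstIndex_one]
    · have := fstIndex_of_mul hy (g := 1) (by simp [fstIndex_one])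
      rw [mul_one] at this
      rw [this]
      simpa using hi.symm
  induction g using normal_induction with
  | one => exact .inl rfl
  | cons j x g hx h ih =>
    right
    rw [fstIndex_of_mul hx h, mul_assoc]
    rcases ih with rfl | ih | ⟨hn, h1⟩
    · by_cases hj : j = n
      · subst hj
        rw [one_mul, ← map_mul]
        by_cases hxy : x * y = 1
        · exact .inr ⟨rfl, by simp [hxy]⟩
        · left
          simpa using fstIndex_of_mul hxy (g := 1) (by simp [fstIndex_one])
      · left
        rw [one_mul]
        exact fstIndex_of_mul hx (hof hj)
    · left
      exact fstIndex_of_mul hx (by rwa [ih])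
    · left
      rw [h1]
      exact fstIndex_of_mul hx (by simp [fstIndex_one])

/-! ### First syllables under endomorphisms that act by partial conjugation -/

section Image

variable {S B : Set ι} {f : CoprodI G →* CoprodI G} {c : CoprodI G}

/-- Normal forms under an injective endomorphism that preserves the subgroup generated by the
factors in `S`, conjugates the factors in `B` by an element `c` of that subgroup, and fixes the
other factors. -/
lemma exists_image_decomposition (hf : Function.Injective f)
    (hc : c ∈ factors G S) (hS : ∀ d ∈ factors G S, f d ∈ factors G S)
    (hB : ∀ i ∈ B, ∀ y : G i, f (of y) = c * of y * c⁻¹)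
    (hA : ∀ i ∉ S ∪ B, ∀ y : G i, f (of y) = of y) (g : CoprodI G) :
    ∃ d ∈ factors G S, ∃ v v', (∀ i ∈ S, fstIndex v ≠ some i) ∧ fstIndex v' = fstIndex v ∧
      g = d * v ∧
      (((∃ i ∈ B, fstIndex v = some i) ∧ f g = f d * c * v') ∨
        ((∀ i ∈ B, fstIndex v ≠ some i) ∧ f g = f d * v')) := by
  -- If `e ≠ 1`, then `e * v` begins in `S`, hence not with `i`; only `e = 1` needs an argument.
  have key : ∀ {e v : CoprodI G} {i : ι}, e ∈ factors G S → (∀ j ∈ S, fstIndex v ≠ some j) →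
      i ∉ S → (e = 1 → fstIndex v ≠ some i) → fstIndex (e * v) ≠ some i := by
    intro e v i he hv hi h1
    by_cases h : e = 1
    · rw [h, one_mul]; exact h1 h
    · obtain ⟨j, hj, hj'⟩ := fstIndex_mul_of_mem_factors he h hv
      rw [hj']
      rintro h'
      exact hi (Option.some.inj h' ▸ hj)
  induction g using normal_induction with
  | one => exact ⟨1, one_mem _, 1, 1, by simp [fstIndex_one]⟩
  | cons i y g hy hg ih =>
    obtain ⟨d, hd, v, v', hv, hvv', rfl, hfg⟩ := ih
    by_cases hiS : i ∈ S
    · refine ⟨of y * d, mul_mem (of_mem_factors hiS y) hd, v, v', hv, hvv', by rw [mul_assoc], ?_⟩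
      rcases hfg with ⟨h, h'⟩ | ⟨h, h'⟩
      · exact .inl ⟨h, by rw [map_mul, h', map_mul]; simp only [mul_assoc]⟩
      · exact .inr ⟨h, by rw [map_mul, h', map_mul]; simp only [mul_assoc]⟩
    have hv'S : ∀ j ∈ S, fstIndex v' ≠ some j := by rwa [hvv']
    -- Since the word `y * (d * v)` is reduced, `v` does not begin with `i` when `d = 1`.
    -- Injectivity of `f` carries this over to the condition `f d = 1`.
    have hd1 : f d = 1 → fstIndex v' ≠ some i := by
      intro h
      obtain rfl : d = 1 := hf (by rw [h, map_one])
      rw [hvv']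
      simpa using hg
    have hne : ∀ j ∈ S, fstIndex (of y * (d * v)) ≠ some j := by
      rw [fstIndex_of_mul hy hg]
      rintro j hj h
      exact hiS (Option.some.inj h ▸ hj)
    by_cases hiB : i ∈ B
    -- The image is `c * y * c⁻¹ * f (d * v)`. The leading `c` is split off and `c⁻¹` goes into
    -- `v'`, where it meets either a `c` in front of the image of a word beginning in `B`, or a word
    -- beginning outside `B`; in both cases no syllable `i` comes next to `y`.
    · refine ⟨1, one_mem _, of y * (d * v), of y * (c⁻¹ * f (d * v)), hne, ?_, by rw [one_mul],
        .inl ⟨⟨i, hiB, fstIndex_of_mul hy hg⟩, by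
          rw [map_mul, hB i hiB, map_one]; simp only [mul_assoc, one_mul]⟩⟩
      rw [fstIndex_of_mul hy hg]
      refine fstIndex_of_mul hy ?_
      rcases hfg with ⟨h, h'⟩ | ⟨h, h'⟩
      · rw [h', show c⁻¹ * (f d * c * v') = (c⁻¹ * f d * c) * v' by group]
        refine key (mul_mem (mul_mem (inv_mem hc) (hS d hd)) hc) hv'S hiS fun h1 => hd1 ?_
        have : c⁻¹ * f d * c = c⁻¹ * 1 * c := by rw [h1]; group
        exact mul_left_cancel (mul_right_cancel this)
      · rw [h', ← mul_assoc]
        exact key (mul_mem (inv_mem hc) (hS d hd)) hv'S hiS fun _ => by rw [hvv']; exact h i hiB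
    · refine ⟨1, one_mem _, of y * (d * v), of y * f (d * v), hne, ?_, by rw [one_mul],
        .inr ⟨?_, by rw [map_mul, hA i (by simp [hiS, hiB]), map_one, one_mul]⟩⟩
      · rw [fstIndex_of_mul hy hg]
        refine fstIndex_of_mul hy ?_
        rcases hfg with ⟨⟨j, hj, h⟩, h'⟩ | ⟨h, h'⟩
        · rw [h']
          refine key (mul_mem (hS d hd) hc) hv'S hiS fun _ => ?_
          rw [hvv', h]
          rintro h
          exact hiB (Option.some.inj h ▸ hj)
        · rw [h']
          exact key (hS d hd) hv'S hiS hd1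
      · rw [fstIndex_of_mul hy hg]
        rintro j hj h
        exact hiB (Option.some.inj h ▸ hj)

lemma exists_image_of_fstIndex (hf : Function.Injective f)
    (hc : c ∈ factors G S) (hS : ∀ d ∈ factors G S, f d ∈ factors G S)
    (hB : ∀ i ∈ B, ∀ y : G i, f (of y) = c * of y * c⁻¹)
    (hA : ∀ i ∉ S ∪ B, ∀ y : G i, f (of y) = of y) {g : CoprodI G}
    (hg : ∀ i ∈ S, fstIndex g ≠ some i) :
    ∃ v, fstIndex v = fstIndex g ∧
      (((∃ i ∈ B, fstIndex g = some i) ∧ f g = c * v) ∨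
        ((∀ i ∈ B, fstIndex g ≠ some i) ∧ f g = v)) := by
  obtain ⟨d, hd, v, v', hv, hvv', rfl, h⟩ := exists_image_decomposition hf hc hS hB hA g
  have hd1 : d = 1 := by
    by_contra h1
    obtain ⟨i, hi, hi'⟩ := fstIndex_mul_of_mem_factors hd h1 hv
    exact hg i hi hi'
  subst hd1
  simp only [map_one, one_mul] at h ⊢
  exact ⟨v', hvv', h⟩

end Image

end Monoid.CoprodI

/-- The sequence `s_0, …, s_N` satisfies the relations of the braid group. Far commutation is
required of all indices. -/
structure BraidRelations {B : Type*} [Group B] (N : ℕ) (s : ℕ → B) : Prop where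
  comm : ∀ i j, i + 2 ≤ j → Commute (s i) (s j)
  braid : ∀ i, i < N → s i * s (i + 1) * s i = s (i + 1) * s i * s (i + 1)

/-! ### Combing: consequences of the braid relations in an arbitrary group -/

namespace BraidRelations

variable {B : Type*} [Group B] {N : ℕ} (s : ℕ → B)

/-- The pure braids `a_k = (s_k ⋯ s_{N-1}) s_N² (s_k ⋯ s_{N-1})⁻¹`, indexed by `N - k`. -/
def strandPushAux (N : ℕ) : ℕ → B
  | 0 => s N ^ 2
  | d + 1 => s (N - (d + 1)) * strandPushAux N d * (s (N - (d + 1)))⁻¹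

/-- The pure braid in which the last strand turns around the `k`-th one:
`a_k = (s_k ⋯ s_{N-1}) s_N² (s_k ⋯ s_{N-1})⁻¹`. -/
def strandPush (N k : ℕ) : B := strandPushAux s N (N - k)

lemma strandPush_self : strandPush s N N = s N ^ 2 := by
  simp [strandPush, strandPushAux]

lemma strandPush_of_lt {k : ℕ} (hk : k < N) :
    strandPush s N k = s k * strandPush s N (k + 1) * (s k)⁻¹ := by
  unfold strandPush
  obtain ⟨d, rfl⟩ : ∃ d, N = k + 1 + d := Nat.exists_eq_add_of_le hk
  rw [show k + 1 + d - k = d + 1 by omega, show k + 1 + d - (k + 1) = d by omega, strandPushAux,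
    show k + 1 + d - (d + 1) = k by omega]

/-- The braids `s_N s_{N-1} ⋯ s_j`, indexed by `N + 1 - j`. -/
def strandCycleAux (N : ℕ) : ℕ → B
  | 0 => 1
  | d + 1 => strandCycleAux N d * s (N - d)

/-- The braid `s_N s_{N-1} ⋯ s_j`. -/
def strandCycle (N j : ℕ) : B := strandCycleAux s N (N + 1 - j)

lemma strandCycle_top : strandCycle s N (N + 1) = 1 := by
  simp [strandCycle, strandCycleAux]

lemma strandCycle_of_le {j : ℕ} (hj : j ≤ N) :
    strandCycle s N j = strandCycle s N (j + 1) * s j := by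
  unfold strandCycle
  obtain ⟨d, rfl⟩ : ∃ d, N = j + d := Nat.exists_eq_add_of_le hj
  rw [show j + d + 1 - j = d + 1 by omega, show j + d + 1 - (j + 1) = d by omega, strandCycleAux,
    show j + d - d = j by omega]

variable {s}

lemma commute_strandPush_of_lt (hs : BraidRelations N s) {j k : ℕ} (hk : k ≤ N)
    (hjk : j + 2 ≤ k) : Commute (s j) (strandPush s N k) := by
  induction hk using Nat.decreasingInduction with
  | self => rw [strandPush_self]; exact (hs.comm _ _ hjk).pow_right 2
  | of_succ k hk ih =>
    rw [strandPush_of_lt s hk]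
    have := hs.comm _ _ hjk
    exact (this.mul_right (ih (by omega))).mul_right this.inv_right

lemma commute_strandCycle_of_lt (hs : BraidRelations N s) {i j : ℕ} (hj : j ≤ N + 1)
    (hij : i + 2 ≤ j) : Commute (s i) (strandCycle s N j) := by
  induction hj using Nat.decreasingInduction with
  | self => rw [strandCycle_top]; exact Commute.one_right _
  | of_succ j hj ih =>
    rw [strandCycle_of_le s (by omega)]
    exact (ih (by omega)).mul_right (hs.comm _ _ hij)

/-- For `k = j - 1`, both elements are conjugates by `s_{j-1} s_j`: `s_j` of `s_{j-1}`, and the push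
of `a_{j+1}`, which commute. Smaller `k` follow by conjugation with generators far from `s_j`. -/
lemma commute_strandPush_of_gt (hs : BraidRelations N s) {j k : ℕ} (hkj : k < j) (hj : j < N) :
    Commute (s j) (strandPush s N k) := by
  obtain ⟨j, rfl⟩ : ∃ i, j = i + 1 := ⟨j - 1, by omega⟩
  have hk : k ≤ j := by omega
  induction hk using Nat.decreasingInduction with
  | self =>
    rw [strandPush_of_lt s (by omega), strandPush_of_lt s hj]
    have h1 := hs.commute_strandPush_of_lt (N := N) (j := j) (k := j + 1 + 1) hj (by omega)
    have h2 := hs.braid j (by omega)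
    set x := s j
    set y := s (j + 1)
    set u := strandPush s N (j + 1 + 1)
    have e : x * (y * u * y⁻¹) * x⁻¹ = (x * y) * u * (x * y)⁻¹ := by group
    have h3 : y * (x * y) = (x * y) * x := by simp only [mul_assoc] at h2 ⊢; exact h2.symm
    rw [e]
    have h4 : y = (x * y) * x * (x * y)⁻¹ := by rw [← h3]; group
    have h5 : Commute ((x * y) * x * (x * y)⁻¹) ((x * y) * u * (x * y)⁻¹) :=
      (Commute.conj_iff (x * y)).2 h1
    rwa [← h4] at h5
  | of_succ k hk ih =>
    rw [strandPush_of_lt s (by omega)]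
    have := (hs.comm k (j + 1) (by omega)).symm
    exact (this.mul_right (ih (by omega))).mul_right this.inv_right

/-- This length-four relation between `s_j` and `a_{j+1}` yields both nontrivial conjugation
formulas below. For the top index it comes from `x y x` interchanging `x` and `y` under conjugation;
lower indices are conjugate to it. -/
lemma commute_strandPush_mul (hs : BraidRelations N s) {j : ℕ} (hj : j < N) :
    s j * strandPush s N (j + 1) * s j * strandPush s N (j + 1) =
      strandPush s N (j + 1) * s j * strandPush s N (j + 1) * s j := by
  obtain ⟨N, rfl⟩ : ∃ M, N = M + 1 := ⟨N - 1, by omega⟩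
  have hj' : j ≤ N := by omega
  induction hj' using Nat.decreasingInduction with
  | self =>
    rw [strandPush_self]
    have h := hs.braid N (by omega)
    set x := s N
    set y := s (N + 1)
    have h1 : (x * y * x) * y = x * (x * y * x) := by
      rw [h, ← h]; simp only [mul_assoc] at h ⊢; rw [h]
    have h2 : (x * y * x) * x = y * (x * y * x) := by
      rw [h]; simp only [mul_assoc] at h ⊢; rw [h]
    calc x * y ^ 2 * x * y ^ 2 = x * y * (y * x * y) * y := by simp only [pow_two, mul_assoc]
      _ = x * y * ((x * y * x) * y) := by rw [← h]; simp only [mul_assoc]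
      _ = x * y * x * (x * y * x) := by rw [h1]; simp only [mul_assoc]
      _ = (x * y * x) * x * y * x := by simp only [mul_assoc]
      _ = y * (y * x * y) * y * x := by rw [h2, h]
      _ = y * ((x * y * x) * y) * x := by rw [← h]; simp only [mul_assoc]
      _ = y * ((y * x * y) * y) * x := by rw [h]
      _ = y ^ 2 * x * y ^ 2 * x := by simp only [pow_two, mul_assoc]
  | of_succ j hj ih =>
    have ih := ih (by omega)
    have h1 := hs.commute_strandPush_of_lt (j := j) (k := j + 1 + 1) (by omega) (by omega)
    have h := hs.braid j (by omega)
    rw [strandPush_of_lt s (k := j + 1) (by omega)]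
    set x := s j
    set y := s (j + 1)
    set u := strandPush s (N + 1) (j + 1 + 1)
    -- Conjugation by `y * x` carries the pair for index `j + 1` to the pair for index `j`.
    have hy : MulAut.conj (y * x) y = x := by
      rw [MulAut.conj_apply, ← h]; group
    have hu : MulAut.conj (y * x) u = y * u * y⁻¹ := by
      rw [MulAut.conj_apply, mul_assoc y x u, h1.eq]; group
    have h2 := congrArg (MulAut.conj (y * x)) ih
    generalize MulAut.conj (y * x) = c at hy hu h2
    simpa only [map_mul, hy, hu] using h2

lemma conj_strandPush_self (hs : BraidRelations N s) {j : ℕ} (hj : j < N) :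
    s j * strandPush s N j * (s j)⁻¹ =
      (strandPush s N j)⁻¹ * strandPush s N (j + 1) * strandPush s N j := by
  have h := hs.commute_strandPush_mul hj
  rw [strandPush_of_lt s hj]
  set x := s j
  set u := strandPush s N (j + 1)
  have : x * (x * u * x⁻¹) * x⁻¹ = (x * u * x⁻¹)⁻¹ * (x * u * x * u) * x⁻¹ * x⁻¹ := by group
  rw [this, h]
  group

lemma inv_conj_strandPush_self (hs : BraidRelations N s) {j : ℕ} (hj : j < N) :
    (s j)⁻¹ * strandPush s N (j + 1) * s j =
      strandPush s N (j + 1) * strandPush s N j * (strandPush s N (j + 1))⁻¹ := by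
  have h := hs.commute_strandPush_mul hj
  rw [strandPush_of_lt s hj]
  set x := s j
  set u := strandPush s N (j + 1)
  have : u * (x * u * x⁻¹) * u⁻¹ = x⁻¹ * (x * u * x * u) * x⁻¹ * u⁻¹ := by group
  rw [this, h]
  group

/-- The subgroup generated by the braids in which the last strand turns around another one. -/
def strandPushes (s : ℕ → B) (N : ℕ) : Subgroup B :=
  Subgroup.closure {x | ∃ k ≤ N, x = strandPush s N k}

/-- The subgroup of braids on the strands other than the last. -/
def initialBraids (s : ℕ → B) (N : ℕ) : Subgroup B :=
  Subgroup.closure {x | ∃ j < N, x = s j}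

lemma strandPush_mem {k : ℕ} (hk : k ≤ N) : strandPush s N k ∈ strandPushes s N :=
  Subgroup.subset_closure ⟨k, hk, rfl⟩

/-- Conjugation by `s_j^{±1}` fixes every push except `a_j` and `a_{j+1}`, and sends these two to
words in each other. -/
lemma conj_gen_mem_strandPushes (hs : BraidRelations N s) {j : ℕ} (hj : j < N) {x : B}
    (hx : x ∈ strandPushes s N) :
    s j * x * (s j)⁻¹ ∈ strandPushes s N ∧ (s j)⁻¹ * x * s j ∈ strandPushes s N := by
  have fixed : ∀ {k}, k ≤ N → Commute (s j) (strandPush s N k) →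
      s j * strandPush s N k * (s j)⁻¹ ∈ strandPushes s N ∧
        (s j)⁻¹ * strandPush s N k * s j ∈ strandPushes s N := by
    intro k hk h
    rw [h.eq, mul_inv_cancel_right, mul_assoc, ← h.eq, inv_mul_cancel_left]
    exact ⟨strandPush_mem hk, strandPush_mem hk⟩
  have m0 : strandPush s N j ∈ strandPushes s N := strandPush_mem hj.le
  have m1 : strandPush s N (j + 1) ∈ strandPushes s N := strandPush_mem hj
  induction hx using Subgroup.closure_induction with
  | mem x hx =>
    obtain ⟨k, hk, rfl⟩ := hx
    rcases lt_trichotomy k j with h | rfl | h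
    · exact fixed hk (hs.commute_strandPush_of_gt h hj)
    · rw [hs.conj_strandPush_self hj]
      refine ⟨mul_mem (mul_mem (inv_mem m0) m1) m0, ?_⟩
      rw [strandPush_of_lt s hj]
      convert m1 using 1
      group
    · obtain rfl | h : k = j + 1 ∨ j + 2 ≤ k := by omega
      · rw [← strandPush_of_lt s hj, hs.inv_conj_strandPush_self hj]
        exact ⟨m0, mul_mem (mul_mem m1 m0) (inv_mem m1)⟩
      · exact fixed hk (hs.commute_strandPush_of_lt hk h)
  | one => simp
  | mul x y _ _ hx hy =>
    constructor
    · convert mul_mem hx.1 hy.1 using 1; group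
    · convert mul_mem hx.2 hy.2 using 1; group
  | inv x _ hx =>
    constructor
    · convert inv_mem hx.1 using 1; group
    · convert inv_mem hx.2 using 1; group

lemma conj_mem_strandPushes (hs : BraidRelations N s) {b x : B} (hb : b ∈ initialBraids s N)
    (hx : x ∈ strandPushes s N) : b * x * b⁻¹ ∈ strandPushes s N := by
  induction hb using Subgroup.closure_induction_left with
  | one => simpa using hx
  | mul_left g hg y hy ih =>
    obtain ⟨j, hj, rfl⟩ := hg
    convert (hs.conj_gen_mem_strandPushes hj ih).1 using 1
    group
  | inv_mul_cancel g hg y hy ih =>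
    obtain ⟨j, hj, rfl⟩ := hg
    convert (hs.conj_gen_mem_strandPushes hj ih).2 using 1
    group

/-- Since `y x² y⁻¹ = x⁻¹ y² x` for `x = s_i`, `y = s_{i+1}`, and `x` commutes with `t_{i+2}`, the
element for `i` is the one for `i + 1` conjugated by `s_i⁻¹`, and the pushes are stable under that.
-/
lemma strandCycle_conj_sq_mem (hs : BraidRelations N s) {i : ℕ} (hi : i ≤ N) :
    strandCycle s N (i + 1) * s i ^ 2 * (strandCycle s N (i + 1))⁻¹ ∈ strandPushes s N := by
  induction hi using Nat.decreasingInduction with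
  | self =>
    rw [strandCycle_top, ← strandPush_self]
    simpa using strandPush_mem le_rfl
  | of_succ i hi ih =>
    have h1 := hs.commute_strandCycle_of_lt (N := N) (i := i) (j := i + 1 + 1) (by omega) le_rfl
    have h2 := hs.braid i hi
    rw [strandCycle_of_le s hi]
    convert (hs.conj_gen_mem_strandPushes hi ih).2 using 1
    set x := s i
    set y := s (i + 1)
    set t := strandCycle s N (i + 1 + 1)
    have h3 : x * y * x * y⁻¹ = y * x := by rw [h2]; group
    have h4 : y * x ^ 2 * y⁻¹ = x⁻¹ * y ^ 2 * x := by
      have : y * x ^ 2 * y⁻¹ = x⁻¹ * (x * y * x) * (x * y⁻¹) := by rw [pow_two]; group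
      rw [this, h2]
      have : x⁻¹ * (y * x * y) * (x * y⁻¹) = x⁻¹ * y * (x * y * x * y⁻¹) := by group
      rw [this, h3, pow_two]
      group
    calc t * y * x ^ 2 * (t * y)⁻¹ = t * (y * x ^ 2 * y⁻¹) * t⁻¹ := by group
      _ = t * x⁻¹ * y ^ 2 * (x * t⁻¹) := by rw [h4]; group
      _ = x⁻¹ * t * y ^ 2 * (t⁻¹ * x) := by rw [h1.inv_left.eq, h1.inv_right.eq]
      _ = x⁻¹ * (t * y ^ 2 * t⁻¹) * x := by group

lemma strandCycle_mul_of_gt (hs : BraidRelations N s) {i j : ℕ} (hji : j ≤ i) (hi : i < N) :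
    strandCycle s N j * s (i + 1) = s i * strandCycle s N j := by
  induction hji using Nat.decreasingInduction with
  | self =>
    have h1 := hs.commute_strandCycle_of_lt (N := N) (i := i) (j := i + 1 + 1) (by omega) le_rfl
    have h2 := hs.braid i hi
    rw [strandCycle_of_le s (j := i) (by omega), strandCycle_of_le s (j := i + 1) (by omega)]
    simp only [mul_assoc] at h2 ⊢
    rw [← h2, ← mul_assoc, ← h1.eq, mul_assoc]
  | of_succ j hj ih =>
    rw [strandCycle_of_le s (by omega), mul_assoc, (hs.comm j (i + 1) (by omega)).eq, ← mul_assoc,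
      ih, mul_assoc]

/-- Every braid is the product of a braid in which only the last strand moves, a braid on the other
strands, and one of the cycles `s_N ⋯ s_j`. -/
lemma exists_decomposition (hs : BraidRelations N s) {x : B}
    (hx : x ∈ Subgroup.closure {x | ∃ j ≤ N, x = s j}) :
    ∃ f ∈ strandPushes s N, ∃ b ∈ initialBraids s N, ∃ j ≤ N + 1,
      x = f * b * strandCycle s N j := by
  have gen : ∀ {j}, j < N → s j ∈ initialBraids s N := fun {j} hj =>
    Subgroup.subset_closure ⟨j, hj, rfl⟩
  have push : ∀ {f b q t : B}, f ∈ strandPushes s N → b ∈ initialBraids s N →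
      q ∈ strandPushes s N → ∃ f' ∈ strandPushes s N, f * b * (q * t) = f' * b * t := by
    intro f b q t hf hb hq
    exact ⟨f * (b * q * b⁻¹), mul_mem hf (hs.conj_mem_strandPushes hb hq), by group⟩
  induction hx using Subgroup.closure_induction_right with
  | one => exact ⟨1, one_mem _, 1, one_mem _, N + 1, le_rfl, by simp [strandCycle_top]⟩
  | mul_right x hx g hg ih =>
    obtain ⟨f, hf, b, hb, j, hj, rfl⟩ := ih
    obtain ⟨i, hi, rfl⟩ := hg
    rw [mul_assoc (f * b)]
    -- With `t_j` the cycle: `t_{i+1} s_i = t_i`; for `i + 2 ≤ j` the two commute; `t_i s_i =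
    -- (t_{i+1} s_i² t_{i+1}⁻¹) t_{i+1}` produces a push; and for `i > j`, `t_j s_i = s_{i-1} t_j`.
    rcases lt_trichotomy i j with h | rfl | h
    · obtain rfl | h : j = i + 1 ∨ i + 2 ≤ j := by omega
      · exact ⟨f, hf, b, hb, i, by omega, by rw [strandCycle_of_le s hi]⟩
      · refine ⟨f, hf, b * s i, mul_mem hb (gen (by omega)), j, hj, ?_⟩
        rw [← (hs.commute_strandCycle_of_lt hj h).eq]
        simp only [mul_assoc]
    · obtain ⟨f', hf', e⟩ := push (t := strandCycle s N (i + 1)) hf hb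
        (hs.strandCycle_conj_sq_mem hi)
      refine ⟨f', hf', b, hb, i + 1, by omega, ?_⟩
      rw [← e, strandCycle_of_le s hi, pow_two]
      group
    · obtain ⟨i, rfl⟩ : ∃ k, i = k + 1 := ⟨i - 1, by omega⟩
      refine ⟨f, hf, b * s i, mul_mem hb (gen (by omega)), j, hj, ?_⟩
      rw [hs.strandCycle_mul_of_gt (by omega) (by omega)]
      simp only [mul_assoc]
  | mul_inv_cancel x hx g hg ih =>
    obtain ⟨f, hf, b, hb, j, hj, rfl⟩ := ih
    obtain ⟨i, hi, rfl⟩ := hg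
    rw [mul_assoc (f * b)]
    rcases lt_trichotomy i j with h | rfl | h
    · obtain rfl | h : j = i + 1 ∨ i + 2 ≤ j := by omega
      · obtain ⟨f', hf', e⟩ := push (t := strandCycle s N i) hf hb
          (inv_mem (hs.strandCycle_conj_sq_mem hi))
        refine ⟨f', hf', b, hb, i, by omega, ?_⟩
        rw [← e, strandCycle_of_le s hi, pow_two]
        group
      · refine ⟨f, hf, b * (s i)⁻¹, mul_mem hb (inv_mem (gen (by omega))), j, hj, ?_⟩
        rw [← (hs.commute_strandCycle_of_lt hj h).inv_left.eq]
        simp only [mul_assoc]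
    · exact ⟨f, hf, b, hb, i + 1, by omega, by rw [strandCycle_of_le s hi, mul_inv_cancel_right]⟩
    · obtain ⟨i, rfl⟩ : ∃ k, i = k + 1 := ⟨i - 1, by omega⟩
      refine ⟨f, hf, b * (s i)⁻¹, mul_mem hb (inv_mem (gen (by omega))), j, hj, ?_⟩
      have := hs.strandCycle_mul_of_gt (j := j) (i := i) (by omega) (by omega)
      rw [show strandCycle s N j * (s (i + 1))⁻¹ = (s i)⁻¹ * strandCycle s N j by
        rw [mul_inv_eq_iff_eq_mul, mul_assoc, this, inv_mul_cancel_left]]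
      simp only [mul_assoc]

end BraidRelations

/-! ### Alternating words in two factors -/

namespace Monoid.CoprodI

variable {ι : Type*} {G : ι → Type*} [∀ i, Group (G i)]

lemma fstIndex_alternating_mul {i j : ι} (hij : i ≠ j) {a : G i} {b : G j} (ha : a ≠ 1) (hb : b ≠ 1)
    {v : CoprodI G} (hv : fstIndex v ≠ some j) (m : ℕ) :
    fstIndex ((of a * of b : CoprodI G) ^ (m + 1) * v) = some i := by
  have step : ∀ w : CoprodI G, fstIndex w ≠ some j →
      fstIndex (of a * of b * w) = some i := by
    intro w hw
    rw [mul_assoc]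
    refine fstIndex_of_mul ha ?_
    rw [fstIndex_of_mul hb hw]
    simpa using hij.symm
  induction m with
  | zero => simpa using step v hv
  | succ m ih =>
    rw [pow_succ', mul_assoc]
    exact step _ (by rw [ih]; simpa using hij)

lemma fstIndex_alternating_mul' {i j : ι} (hij : i ≠ j) {a : G i} {b : G j} (ha : a ≠ 1)
    (hb : b ≠ 1) {v : CoprodI G} (hv : fstIndex v ≠ some i) (m : ℕ) :
    fstIndex (of a * (of b * of a : CoprodI G) ^ m * v) = some i := by
  have e : of a * (of b * of a : CoprodI G) ^ m * v = (of a * of b) ^ m * (of a * v) := by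
    rw [← mul_assoc]
    congr 1
    exact (SemiconjBy.pow_right (show SemiconjBy (of a : CoprodI G) (of b * of a) (of a * of b) by
      simp [SemiconjBy, mul_assoc]) m).eq
  rw [e]
  have h := fstIndex_of_mul ha hv
  cases m with
  | zero => simpa using h
  | succ m => exact fstIndex_alternating_mul hij ha hb (by rw [h]; simpa using hij) m

/-- Up to left multiplication by a factor, a nonzero power of an alternating product of two
syllables starts with the other syllable. -/
lemma exists_conj_eq_of_alternating {i n : ι} (hi : i ≠ n) {a : G i} {b : G n} (ha : a ≠ 1)
    (hb : b ≠ 1) {v : CoprodI G} (hvi : fstIndex v ≠ some i) (hvn : fstIndex v ≠ some n)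
    {m : ℤ} (hm : m ≠ 0) {g : CoprodI G} (hg : g = (of b * of a) ^ m ∨ g = (of a * of b) ^ m) :
    ∃ u, fstIndex u = some i ∧ (g * v)⁻¹ * of b * (g * v) = u⁻¹ * of b * u := by
  have ha' : a⁻¹ ≠ 1 := by simpa using ha
  have hb' : b⁻¹ ≠ 1 := by simpa using hb
  -- Whenever the power begins with `b` or `b⁻¹`, that letter commutes with the central `b` and is
  -- dropped, leaving a word that begins in factor `i`.
  obtain ⟨p, rfl | rfl⟩ : ∃ p : ℕ, m = (p + 1 : ℕ) ∨ m = -(p + 1 : ℕ) := by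
    refine ⟨m.natAbs - 1, ?_⟩
    omega
  · rw [zpow_natCast, zpow_natCast] at hg
    rcases hg with rfl | rfl
    · refine ⟨of a * (of b * of a) ^ p * v, fstIndex_alternating_mul' hi ha hb hvi p, ?_⟩
      rw [pow_succ']
      generalize (of b * of a : CoprodI G) ^ p = q
      group
    · exact ⟨_, fstIndex_alternating_mul hi ha hb hvn p, rfl⟩
  · rw [zpow_neg, zpow_neg, zpow_natCast, zpow_natCast, ← inv_pow, ← inv_pow, mul_inv_rev,
      mul_inv_rev, ← map_inv, ← map_inv] at hg
    rcases hg with rfl | rfl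
    · exact ⟨_, fstIndex_alternating_mul hi ha' hb' hvn p, rfl⟩
    · refine ⟨of a⁻¹ * (of b⁻¹ * of a⁻¹) ^ p * v, fstIndex_alternating_mul' hi ha' hb' hvi p, ?_⟩
      rw [pow_succ', map_inv, map_inv]
      generalize ((of b)⁻¹ * (of a)⁻¹ : CoprodI G) ^ p = q
      group

/-- Otherwise `b * v = v * b`; the left side begins in factor `n`, while the right side begins like
`v`, in factor `i`. -/
lemma conj_of_ne {i n : ι} (hi : i ≠ n) {b : G n} (hb : b ≠ 1) {v : CoprodI G}
    (hv : fstIndex v = some i) : v⁻¹ * of b * v ≠ of b := by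
  intro h
  have h' : of b * v = v * of b := by
    calc of b * v = v * (v⁻¹ * of b * v) := by group
      _ = v * of b := by rw [h]
  have h1 : fstIndex (of b * v) = some n := fstIndex_of_mul hb (by rw [hv]; simpa using hi)
  rw [h'] at h1
  rcases fstIndex_mul_of v b with rfl | h2 | ⟨h2, -⟩
  · simp [fstIndex_one] at hv
  · rw [h1, hv] at h2
    exact hi (Option.some.inj h2).symm
  · rw [hv] at h2
    exact hi (Option.some.inj h2)

end Monoid.CoprodI

/-! ### The action of the pushes of the last strand -/

namespace ArtinType

open Monoid.CoprodI

variable {n N : ℕ} {H : Type*} [Group H]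

/-- The generator `σ_k` with an index in `ℕ`, equal to `1` when there is no such generator. -/
def sigma (n k : ℕ) : BraidGroup n := if hk : k < n - 1 then BraidGroup.σ ⟨k, hk⟩ else 1

/-- The inclusion of the factor `H_k`, with an index in `ℕ`. -/
def factor (n k : ℕ) (H : Type*) [Group H] : H →* FreePower n H :=
  if hk : k < n then φ ⟨k, hk⟩ else 1

lemma sigma_relations (N : ℕ) : BraidRelations N (sigma (N + 2)) where
  comm i j hij := by
    unfold sigma
    split_ifs with hi hj
    · have := PresentedGroup.one_of_mem (rels := braidRelators (N + 2))
        (.inl ⟨⟨i, hi⟩, ⟨j, hj⟩, hij, rfl⟩)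
      rw [map_mul, map_inv, mul_inv_eq_one] at this
      exact this
    all_goals simp
  braid i hi := by
    unfold sigma
    rw [dif_pos (show i < N + 2 - 1 by omega), dif_pos (show i + 1 < N + 2 - 1 by omega)]
    have := PresentedGroup.one_of_mem (rels := braidRelators (N + 2))
      (.inr ⟨⟨i, by omega⟩, ⟨i + 1, by omega⟩, rfl, rfl⟩)
    rw [map_mul, map_inv, mul_inv_eq_one] at this
    exact this

section Action

variable (h : H) {k : ℕ}

lemma rep_sigma_lo (hk : k ≤ N) (y : H) :
    artinTypeRep (N + 2) h (sigma (N + 2) k) (factor (N + 2) k H y) =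
      (factor (N + 2) k H h)⁻¹ * factor (N + 2) (k + 1) H y * factor (N + 2) k H h := by
  unfold sigma
  rw [dif_pos (by omega), artinTypeRep_σ, tau_apply]
  convert tauHom_lo (n := N + 2) h ⟨k, by omega⟩ y using 1
  all_goals simp [factor, show k < N + 2 by omega, show k + 1 < N + 2 by omega, lo, hi]

lemma rep_sigma_hi (hk : k ≤ N) (y : H) :
    artinTypeRep (N + 2) h (sigma (N + 2) k) (factor (N + 2) (k + 1) H y) =
      factor (N + 2) k H h * factor (N + 2) k H y * (factor (N + 2) k H h)⁻¹ := by
  unfold sigma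
  rw [dif_pos (by omega), artinTypeRep_σ, tau_apply]
  convert tauHom_hi (n := N + 2) h ⟨k, by omega⟩ y using 1
  all_goals simp [factor, show k < N + 2 by omega, show k + 1 < N + 2 by omega, lo, hi]

lemma rep_sigma_of_ne (hk : k ≤ N) {j : ℕ} (h1 : j ≠ k) (h2 : j ≠ k + 1) (y : H) :
    artinTypeRep (N + 2) h (sigma (N + 2) k) (factor (N + 2) j H y) = factor (N + 2) j H y := by
  unfold sigma factor
  rw [dif_pos (by omega), artinTypeRep_σ, tau_apply]
  split_ifs with hj
  · exact tauHom_of_ne h _ (by simpa [lo] using h1) (by simpa [hi] using h2) y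
  · simp

end Action

/-- The action of the `m`-th power of the pure braid in which the last strand turns around the
`k`-th one. -/
structure IsPush (h : H) (N k : ℕ) (m : ℤ) (f : MulAut (FreePower (N + 2) H)) : Prop where
  lt : ∀ j < k, ∀ y, f (factor (N + 2) j H y) = factor (N + 2) j H y
  self : ∀ y, f (factor (N + 2) k H y) =
    MulAut.conj ((factor (N + 2) (N + 1) H h * factor (N + 2) k H h) ^ (-m) *
      factor (N + 2) k H h ^ (2 * m)) (factor (N + 2) k H y)
  last : ∀ y, f (factor (N + 2) (N + 1) H y) =
    MulAut.conj ((factor (N + 2) (N + 1) H h * factor (N + 2) k H h) ^ (-m) *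
      factor (N + 2) (N + 1) H h ^ (2 * m)) (factor (N + 2) (N + 1) H y)
  gt : ∀ j, k < j → j ≤ N → ∀ y, f (factor (N + 2) j H y) =
    MulAut.conj ((factor (N + 2) (N + 1) H h * factor (N + 2) k H h) ^ (-m) *
      (factor (N + 2) k H h * factor (N + 2) (N + 1) H h) ^ m) (factor (N + 2) j H y)

namespace IsPush

variable {h : H} {k : ℕ} {m m' : ℤ} {f g : MulAut (FreePower (N + 2) H)}

lemma map_self (hf : IsPush h N k m f) : f (factor (N + 2) k H h) =
    MulAut.conj ((factor (N + 2) (N + 1) H h * factor (N + 2) k H h) ^ (-m))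
      (factor (N + 2) k H h) := by
  rw [hf.self]
  simp only [MulAut.conj_apply]
  group

lemma map_last (hf : IsPush h N k m f) : f (factor (N + 2) (N + 1) H h) =
    MulAut.conj ((factor (N + 2) (N + 1) H h * factor (N + 2) k H h) ^ (-m))
      (factor (N + 2) (N + 1) H h) := by
  rw [hf.last]
  simp only [MulAut.conj_apply]
  group

/-- Both letters are conjugated by the same power of their product `h_{N+1} h_k`, which is therefore
fixed. -/
lemma map_prod (hf : IsPush h N k m f) :
    f (factor (N + 2) (N + 1) H h * factor (N + 2) k H h) =
      factor (N + 2) (N + 1) H h * factor (N + 2) k H h := by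
  rw [map_mul, hf.map_self, hf.map_last, ← map_mul, MulAut.conj_apply]
  generalize factor (N + 2) (N + 1) H h * factor (N + 2) k H h = x
  group

lemma map_self_zpow (hf : IsPush h N k m f) (e : ℤ) : f (factor (N + 2) k H h ^ e) =
    MulAut.conj ((factor (N + 2) (N + 1) H h * factor (N + 2) k H h) ^ (-m))
      (factor (N + 2) k H h ^ e) := by
  rw [map_zpow f, hf.map_self]
  exact (map_zpow (MulAut.conj _) _ e).symm

lemma map_last_zpow (hf : IsPush h N k m f) (e : ℤ) : f (factor (N + 2) (N + 1) H h ^ e) =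
    MulAut.conj ((factor (N + 2) (N + 1) H h * factor (N + 2) k H h) ^ (-m))
      (factor (N + 2) (N + 1) H h ^ e) := by
  rw [map_zpow f, hf.map_last]
  exact (map_zpow (MulAut.conj _) _ e).symm

lemma map_prod_zpow (hf : IsPush h N k m f) (e : ℤ) :
    f ((factor (N + 2) k H h * factor (N + 2) (N + 1) H h) ^ e) =
      MulAut.conj ((factor (N + 2) (N + 1) H h * factor (N + 2) k H h) ^ (-m))
        ((factor (N + 2) k H h * factor (N + 2) (N + 1) H h) ^ e) := by
  rw [map_zpow f, map_mul f, hf.map_self, hf.map_last, ← map_mul]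
  exact (map_zpow (MulAut.conj _) _ e).symm

/-- As `f` fixes `P = h_{N+1} h_k` and conjugates powers of `h_k`, `h_{N+1}` and `h_k h_{N+1}` by
`P^{-m}`, the conjugating elements multiply with the inner powers of `P` cancelling, so the
exponents add. -/
lemma mul (hf : IsPush h N k m f) (hg : IsPush h N k m' g) : IsPush h N k (m + m') (f * g) := by
  have h1 := hf.map_self_zpow
  have h2 := hf.map_last_zpow
  have h3 := hf.map_prod
  have h4 := hf.map_prod_zpow
  constructor
  · intro j hj y
    rw [MulAut.mul_apply, hg.lt j hj, hf.lt j hj]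
  · intro y
    rw [MulAut.mul_apply, hg.self, MulAut.conj_apply, map_mul f, map_mul f, map_inv f, map_mul f,
      map_zpow f, h3, h1, hf.self]
    generalize factor (N + 2) (N + 1) H h * factor (N + 2) k H h = P
    generalize factor (N + 2) k H h = a
    generalize factor (N + 2) k H y = x
    simp only [MulAut.conj_apply]
    group
  · intro y
    rw [MulAut.mul_apply, hg.last, MulAut.conj_apply, map_mul f, map_mul f, map_inv f, map_mul f,
      map_zpow f, h3, h2, hf.last]
    generalize factor (N + 2) (N + 1) H h * factor (N + 2) k H h = P
    generalize factor (N + 2) (N + 1) H h = a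
    generalize factor (N + 2) (N + 1) H y = x
    simp only [MulAut.conj_apply]
    group
  · intro j hj hj' y
    rw [MulAut.mul_apply, hg.gt j hj hj', MulAut.conj_apply, map_mul f, map_mul f, map_inv f,
      map_mul f, map_zpow f, h3, h4, hf.gt j hj hj']
    generalize factor (N + 2) (N + 1) H h * factor (N + 2) k H h = P
    generalize factor (N + 2) k H h * factor (N + 2) (N + 1) H h = Q
    simp only [MulAut.conj_apply]
    group

lemma inv (hf : IsPush h N k m f) : IsPush h N k (-m) f⁻¹ := by
  have h1 := hf.map_self_zpow
  have h2 := hf.map_last_zpow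
  have h3 := hf.map_prod
  have h4 := hf.map_prod_zpow
  have e : ∀ {x y}, f y = x → f⁻¹ x = y := by
    rintro x y rfl
    exact MulAut.inv_apply_self _ f y
  constructor
  · intro j hj y
    exact e (hf.lt j hj y)
  · intro y
    apply e
    rw [MulAut.conj_apply, map_mul f, map_mul f, map_inv f, map_mul f,
      map_zpow f, h3, h1, hf.self]
    generalize factor (N + 2) (N + 1) H h * factor (N + 2) k H h = P
    generalize factor (N + 2) k H h = a
    generalize factor (N + 2) k H y = x
    simp only [MulAut.conj_apply]
    group
  · intro y
    apply e
    rw [MulAut.conj_apply, map_mul f, map_mul f, map_inv f, map_mul f,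
      map_zpow f, h3, h2, hf.last]
    generalize factor (N + 2) (N + 1) H h * factor (N + 2) k H h = P
    generalize factor (N + 2) (N + 1) H h = a
    generalize factor (N + 2) (N + 1) H y = x
    simp only [MulAut.conj_apply]
    group
  · intro j hj hj' y
    apply e
    rw [MulAut.conj_apply, map_mul f, map_mul f, map_inv f,
      map_mul f, map_zpow f, h3, h4, hf.gt j hj hj']
    generalize factor (N + 2) (N + 1) H h * factor (N + 2) k H h = P
    generalize factor (N + 2) k H h * factor (N + 2) (N + 1) H h = Q
    simp only [MulAut.conj_apply]
    group

lemma zpow (hf : IsPush h N k 1 f) (m : ℤ) : IsPush h N k m (f ^ m) := by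
  induction m with
  | zero => constructor <;> simp
  | succ m ih => rw [zpow_add_one]; exact ih.mul hf
  | pred m ih => rw [zpow_sub_one]; exact ih.mul hf.inv

end IsPush

lemma isPush_self (h : H) :
    IsPush h N N 1 (artinTypeRep (N + 2) h (BraidRelations.strandPush (sigma (N + 2)) N N)) := by
  rw [BraidRelations.strandPush_self, map_pow]
  have t1 := rep_sigma_lo (N := N) h le_rfl
  have t2 := rep_sigma_hi (N := N) h le_rfl
  constructor
  · intro j hj y
    have := rep_sigma_of_ne h (le_refl N) (j := j) (by omega) (by omega) y
    rw [pow_two, MulAut.mul_apply, this, this]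
  · intro y
    rw [pow_two, MulAut.mul_apply, t1, map_mul, map_mul, map_inv, t1, t2, MulAut.conj_apply]
    generalize factor (N + 2) N H h = a
    generalize factor (N + 2) N H y = x
    simp only [mul_one, zpow_neg, zpow_ofNat, pow_two, mul_inv_rev, mul_assoc, inv_inv]
    group
  · intro y
    rw [pow_two, MulAut.mul_apply, t2, map_mul, map_mul, map_inv, t1, t1, MulAut.conj_apply]
    group
  · intro j hj hj'
    omega

lemma isPush_strandPush (h : H) {k : ℕ} (hk : k ≤ N) :
    IsPush h N k 1 (artinTypeRep (N + 2) h (BraidRelations.strandPush (sigma (N + 2)) N k)) := by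
  induction hk using Nat.decreasingInduction with
  | self => exact isPush_self h
  | of_succ k hk ih =>
    have t1 := rep_sigma_lo (N := N) h (k := k) hk.le
    have t2 := rep_sigma_hi (N := N) h (k := k) hk.le
    have t3 := fun {j} => rep_sigma_of_ne (N := N) h (k := k) hk.le (j := j)
    have tl := t3 (j := N + 1) (by omega) (by omega)
    rw [BraidRelations.strandPush_of_lt _ hk, map_mul, map_mul, map_inv]
    generalize artinTypeRep (N + 2) h (sigma (N + 2) k) = τ at *
    generalize artinTypeRep (N + 2) h (BraidRelations.strandPush (sigma (N + 2)) N (k + 1)) = f at *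
    -- Explicit preimages under `τ` avoid computing `τ⁻¹`.
    have e : ∀ {x x' y}, τ x' = x → τ (f x') = y → (τ * f * τ⁻¹) x = y := by
      rintro x x' y rfl rfl
      simp [MulAut.mul_apply]
    have hP : τ (factor (N + 2) (N + 1) H h * factor (N + 2) (k + 1) H h) =
        factor (N + 2) (N + 1) H h * factor (N + 2) k H h := by
      rw [map_mul, tl, t2]; group
    constructor
    · intro j hj y
      have := t3 (j := j) (by omega) (by omega) y
      exact e this (by rw [ih.lt j (by omega), this])
    · intro y
      refine e (x' := factor (N + 2) (k + 1) H (h⁻¹ * y * h)) ?_ ?_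
      · rw [t2]; simp only [map_mul, map_inv]; group
      · rw [ih.self, MulAut.conj_apply, map_mul τ, map_mul τ, map_inv τ, map_mul τ, map_zpow τ, hP,
          map_zpow τ, t2, t2, MulAut.conj_apply]
        simp only [map_mul, map_inv]
        group
    · intro y
      refine e (tl y) ?_
      rw [ih.last, MulAut.conj_apply, map_mul τ, map_mul τ, map_inv τ, map_mul τ, map_zpow τ, hP,
          map_zpow τ, tl, tl, MulAut.conj_apply]
    · intro j hj hj' y
      obtain rfl | hj2 : j = k + 1 ∨ k + 2 ≤ j := by omega
      · refine e (x' := factor (N + 2) (k + 1) H h * factor (N + 2) k H y *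
          (factor (N + 2) (k + 1) H h)⁻¹) ?_ ?_
        · rw [map_mul, map_mul, map_inv, t1, t2]; group
        · rw [map_mul f, map_mul f, map_inv f, ih.map_self, ih.lt k (by omega),
            MulAut.conj_apply, map_mul τ, map_mul τ, map_inv τ, map_mul τ, map_mul τ, map_inv τ,
            map_zpow τ, hP, t2, t1, MulAut.conj_apply]
          group
      · refine e (t3 (j := j) (by omega) (by omega) y) ?_
        rw [ih.gt j (by omega) hj', MulAut.conj_apply, map_mul τ, map_mul τ, map_inv τ, map_mul τ,
          map_zpow τ, hP, map_zpow τ, map_mul τ, tl, t2, t3 (by omega) (by omega),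
          MulAut.conj_apply]
        group

end ArtinType

/-! ### Ping-pong for the pushes -/

namespace ArtinType

open Monoid.CoprodI BraidRelations

variable {n N : ℕ} {H : Type*} [Group H]

lemma factor_eq_of {k : ℕ} (hk : k < n) :
    factor n k H = of (M := fun _ : Fin n => H) (i := ⟨k, hk⟩) := by
  simp [factor, hk, φ]

lemma factor_mem_factors {S : Set (Fin n)} {k : ℕ} (hk : k < n) (hS : (⟨k, hk⟩ : Fin n) ∈ S)
    (y : H) : factor n k H y ∈ factors (fun _ : Fin n => H) S := by
  rw [factor_eq_of hk]
  exact of_mem_factors (G := fun _ : Fin n => H) hS y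

lemma IsPush.map_mem_factors {h : H} {k : ℕ} (hk : k ≤ N) {m : ℤ} {f : MulAut (FreePower (N + 2) H)}
    (hf : IsPush h N k m f) {d : FreePower (N + 2) H}
    (hd : d ∈ factors (fun _ : Fin (N + 2) => H) {⟨k, by omega⟩, Fin.last (N + 1)}) :
    f d ∈ factors (fun _ : Fin (N + 2) => H) {⟨k, by omega⟩, Fin.last (N + 1)} := by
  have ha : ∀ y, factor (N + 2) k H y ∈
      factors (fun _ : Fin (N + 2) => H) {⟨k, by omega⟩, Fin.last (N + 1)} :=
    factor_mem_factors (by omega) (.inl rfl)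
  have hz : ∀ y, factor (N + 2) (N + 1) H y ∈
      factors (fun _ : Fin (N + 2) => H) {⟨k, by omega⟩, Fin.last (N + 1)} :=
    factor_mem_factors (by omega) (.inr rfl)
  induction hd using Subgroup.closure_induction with
  | mem x hx =>
    obtain ⟨i, hi | hi, y, rfl⟩ := hx
    · subst hi
      rw [← factor_eq_of, hf.self, MulAut.conj_apply]
      have := mul_mem (zpow_mem (mul_mem (hz h) (ha h)) (-m)) (zpow_mem (ha h) (2 * m))
      exact mul_mem (mul_mem this (ha y)) (inv_mem this)
    · obtain rfl : i = ⟨N + 1, by omega⟩ := hi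
      rw [← factor_eq_of, hf.last, MulAut.conj_apply]
      have := mul_mem (zpow_mem (mul_mem (hz h) (ha h)) (-m)) (zpow_mem (hz h) (2 * m))
      exact mul_mem (mul_mem this (hz y)) (inv_mem this)
  | one => rw [map_one]; exact one_mem _
  | mul x y _ _ hx hy => rw [map_mul]; exact mul_mem hx hy
  | inv x _ hx => rw [map_inv]; exact inv_mem hx

/-- The ping-pong step. Here `f` conjugates the factors strictly between `k` and the last by `P^{-m}
Q^m` and sends `z` to `P^{-m} z P^m`, so the new conjugator is `P^m * f v`: a nonzero power of `P`
or `Q` followed by an element that begins in the same factor as `v`. -/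
lemma IsPush.exists_conj_last {h : H} (hh : h ≠ 1) {k : ℕ} (hk : k ≤ N) {m : ℤ} (hm : m ≠ 0)
    {f : MulAut (FreePower (N + 2) H)} (hf : IsPush h N k m f) {v : FreePower (N + 2) H}
    (hvk : fstIndex v ≠ some ⟨k, by omega⟩) (hvl : fstIndex v ≠ some (Fin.last (N + 1))) :
    ∃ u : FreePower (N + 2) H, fstIndex u = some ⟨k, by omega⟩ ∧
      f (v⁻¹ * factor (N + 2) (N + 1) H h * v) = u⁻¹ * factor (N + 2) (N + 1) H h * u := by
  set P := factor (N + 2) (N + 1) H h * factor (N + 2) k H h with hP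
  set Q := factor (N + 2) k H h * factor (N + 2) (N + 1) H h with hQ
  have ez : factor (N + 2) (N + 1) H = of (M := fun _ : Fin (N + 2) => H) (i := Fin.last (N + 1)) :=
    factor_eq_of (by omega)
  have ea : factor (N + 2) k H = of (M := fun _ : Fin (N + 2) => H) (i := ⟨k, by omega⟩) :=
    factor_eq_of (by omega)
  have ha : factor (N + 2) k H h ∈
      factors (fun _ : Fin (N + 2) => H) {⟨k, by omega⟩, Fin.last (N + 1)} :=
    factor_mem_factors (by omega) (.inl rfl) h
  have hz : factor (N + 2) (N + 1) H h ∈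
      factors (fun _ : Fin (N + 2) => H) {⟨k, by omega⟩, Fin.last (N + 1)} :=
    factor_mem_factors (by omega) (.inr rfl) h
  obtain ⟨v', hv', hfv⟩ := exists_image_of_fstIndex (G := fun _ : Fin (N + 2) => H)
    (S := {⟨k, by omega⟩, Fin.last (N + 1)}) (B := {j | k < j.val ∧ j.val ≤ N})
    (f := f.toMonoidHom) (c := P ^ (-m) * Q ^ m) (g := v) f.injective
    (mul_mem (zpow_mem (mul_mem hz ha) _) (zpow_mem (mul_mem ha hz) _))
    (fun d hd => hf.map_mem_factors hk hd)
    (by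
      rintro i ⟨hi, hi'⟩ y
      have := hf.gt i hi hi' y
      rw [factor_eq_of i.isLt, MulAut.conj_apply] at this
      exact this)
    (by
      intro i hi y
      have hlt : i.val < k := by
        by_contra hlt
        refine hi ?_
        have := i.isLt
        obtain h1 | h1 | h1 : i.val = k ∨ i.val = N + 1 ∨ (k < i.val ∧ i.val ≤ N) := by omega
        · exact .inl (.inl (Fin.ext h1))
        · exact .inl (.inr (Fin.ext h1))
        · exact .inr h1
      have := hf.lt i hlt y
      rw [factor_eq_of i.isLt] at this
      exact this)
    (by
      rintro i (rfl | rfl)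
      · exact hvk
      · exact hvl)
  -- The power is `Q ^ m` when `v` begins in a conjugated factor, and `P ^ m` otherwise.
  have hfv' : ∃ g, (g = P ^ m ∨ g = Q ^ m) ∧ P ^ m * f v = g * v' := by
    rcases hfv with ⟨-, hfv⟩ | ⟨-, hfv⟩
    · refine ⟨_, .inr rfl, ?_⟩
      rw [show f v = P ^ (-m) * Q ^ m * v' from hfv]
      group
    · refine ⟨_, .inl rfl, ?_⟩
      rw [show f v = v' from hfv]
  obtain ⟨g, hg, hgv⟩ := hfv'
  have hfz : f (v⁻¹ * factor (N + 2) (N + 1) H h * v) =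
      (g * v')⁻¹ * factor (N + 2) (N + 1) H h * (g * v') := by
    rw [map_mul, map_mul, map_inv, hf.map_last, MulAut.conj_apply, ← hgv, ← hP]
    group
  rw [hfz]
  rw [hP, hQ, ea, ez] at hg
  rw [ez]
  exact exists_conj_eq_of_alternating (by
    intro h
    have := congrArg Fin.val h
    simp at this
    omega) hh hh (by rw [hv']; exact hvk) (by rw [hv']; exact hvl) hm hg

/-- The pushes of the last strand, as a homomorphism from a free group. -/
def pushHom (N : ℕ) :
    Monoid.CoprodI (fun _ : Fin (N + 1) => Multiplicative ℤ) →* BraidGroup (N + 2) :=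
  lift fun i => zpowersHom _ (strandPush (sigma (N + 2)) N i)

lemma strandPushes_le_range : strandPushes (sigma (N + 2)) N ≤ (pushHom N).range := by
  refine (Subgroup.closure_le _).2 ?_
  rintro _ ⟨k, hk, rfl⟩
  refine ⟨of (i := ⟨k, by omega⟩) (Multiplicative.ofAdd 1), ?_⟩
  rw [pushHom, lift_of]
  simp

/-- The first letter of `w` acts last. By induction the conjugator for the rest of `w` begins
neither in factor `k`, as `w` is reduced, nor in the last factor, so the ping-pong step applies. -/
lemma pushHom_apply_last {h : H} (hh : h ≠ 1)
    (w : Monoid.CoprodI (fun _ : Fin (N + 1) => Multiplicative ℤ)) :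
    w = 1 ∨ ∃ k : Fin (N + 1), fstIndex w = some k ∧ ∃ u : FreePower (N + 2) H,
      fstIndex u = some k.castSucc ∧
      artinTypeRep (N + 2) h (pushHom N w) (factor (N + 2) (N + 1) H h) =
        u⁻¹ * factor (N + 2) (N + 1) H h * u := by
  induction w using normal_induction with
  | one => exact .inl rfl
  | cons k m w hm hw ih =>
    refine .inr ⟨k, fstIndex_of_mul hm hw, ?_⟩
    have hp : pushHom N (of (M := fun _ : Fin (N + 1) => Multiplicative ℤ) (i := k) m) =
        strandPush (sigma (N + 2)) N k ^ Multiplicative.toAdd m := by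
      rw [pushHom, lift_of]; simp
    have push := (isPush_strandPush (N := N) h (k := k) (by omega)).zpow (Multiplicative.toAdd m)
    rw [map_mul, hp, map_mul, map_zpow, MulAut.mul_apply]
    obtain ⟨v, hv, hv', e⟩ : ∃ v : FreePower (N + 2) H, fstIndex v ≠ some k.castSucc ∧
        fstIndex v ≠ some (Fin.last (N + 1)) ∧
        artinTypeRep (N + 2) h (pushHom N w) (factor (N + 2) (N + 1) H h) =
          v⁻¹ * factor (N + 2) (N + 1) H h * v := by
      rcases ih with rfl | ⟨j, hj, u, hu, e⟩
      · exact ⟨1, by simp [fstIndex_one], by simp [fstIndex_one], by simp⟩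
      · refine ⟨u, ?_, ?_, e⟩
        · rw [hj] at hw
          rw [hu]
          simpa using hw
        · rw [hu]
          simp
    rw [e]
    exact push.exists_conj_last hh (by omega) (by simpa using hm) hv hv'

lemma eq_one_of_mem_strandPushes {h : H} (hh : h ≠ 1) {x : BraidGroup (N + 2)}
    (hx : x ∈ strandPushes (sigma (N + 2)) N)
    (hxz : artinTypeRep (N + 2) h x (factor (N + 2) (N + 1) H h) = factor (N + 2) (N + 1) H h) :
    x = 1 := by
  obtain ⟨w, rfl⟩ := strandPushes_le_range hx
  rcases pushHom_apply_last hh w with rfl | ⟨k, -, u, hu, e⟩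
  · rw [map_one]
  · rw [hxz, factor_eq_of (by omega)] at e
    exact absurd e.symm (conj_of_ne (Fin.castSucc_lt_last k).ne hh hu)

end ArtinType

/-! ### Deleting the last strand, and the induction -/

namespace ArtinType

open Monoid.CoprodI BraidRelations

variable {n N : ℕ} {H : Type*} [Group H]

lemma closure_sigma (N : ℕ) (x : BraidGroup (N + 2)) :
    x ∈ Subgroup.closure {x | ∃ j ≤ N, x = sigma (N + 2) j} := by
  refine PresentedGroup.generated_by (braidRelators (N + 2)) _ (fun i => ?_) x
  refine Subgroup.subset_closure ⟨i, ?_, ?_⟩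
  · have := i.isLt
    omega
  · rw [sigma, dif_pos i.isLt]
    rfl

/-- The homomorphism that kills the last factor. -/
def killLast (N : ℕ) (H : Type*) [Group H] : FreePower (N + 2) H →* FreePower (N + 1) H :=
  lift fun i => factor (N + 1) i H

lemma killLast_factor (j : ℕ) (hj : j < N + 2) (y : H) :
    killLast N H (factor (N + 2) j H y) = factor (N + 1) j H y := by
  rw [killLast, factor_eq_of hj, lift_of]

/-- The out-of-range value of `factor` is the trivial homomorphism, so `killLast` needs no case
distinction. -/
lemma factor_last_eq_one (y : H) : factor (N + 1) (N + 1) H y = 1 := by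
  simp [factor]

/-- The inclusion of the braid group on one strand less. -/
def addStrand (N : ℕ) : BraidGroup (N + 1) →* BraidGroup (N + 2) :=
  PresentedGroup.toGroup (rels := braidRelators (N + 1)) 
    (f := fun k : Fin (N + 1 - 1) => sigma (N + 2) k) (by
    rintro r (⟨i, j, hij, rfl⟩ | ⟨i, j, hij, rfl⟩)
    · simp only [map_mul, map_inv, FreeGroup.lift_apply_of]
      exact mul_inv_eq_one.2 ((sigma_relations N).comm _ _ hij)
    · simp only [map_mul, map_inv, FreeGroup.lift_apply_of]
      rw [← hij]
      have := j.isLt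
      exact mul_inv_eq_one.2 ((sigma_relations N).braid _ (by omega)))

lemma addStrand_sigma {j : ℕ} (hj : j < N) : addStrand N (sigma (N + 1) j) = sigma (N + 2) j := by
  rw [sigma, dif_pos (by omega)]
  exact PresentedGroup.toGroup.of (rels := braidRelators (N + 1)) _

lemma initialBraids_le_range : initialBraids (sigma (N + 2)) N ≤ (addStrand N).range := by
  refine (Subgroup.closure_le _).2 ?_
  rintro _ ⟨j, hj, rfl⟩
  exact ⟨_, addStrand_sigma hj⟩

lemma killLast_rep_addStrand (h : H) (b : BraidGroup (N + 1)) (g : FreePower (N + 2) H) :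
    killLast N H (artinTypeRep (N + 2) h (addStrand N b) g) =
      artinTypeRep (N + 1) h b (killLast N H g) := by
  have gen : ∀ (k : Fin (N + 1 - 1)) (g : FreePower (N + 2) H),
      killLast N H (artinTypeRep (N + 2) h (addStrand N (PresentedGroup.of k)) g) =
        artinTypeRep (N + 1) h (PresentedGroup.of k) (killLast N H g) := by
    intro k g
    obtain ⟨N, rfl⟩ : ∃ M, N = M + 1 := ⟨N - 1, by have := k.isLt; omega⟩
    have hk : k.val ≤ N := by have := k.isLt; omega
    have e : (PresentedGroup.of k : BraidGroup (N + 1 + 1)) = sigma (N + 2) k := by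
      rw [sigma, dif_pos k.isLt]; rfl
    rw [e, addStrand_sigma (by omega)]
    induction g using Monoid.CoprodI.induction_on with
    | one => simp
    | mul x y hx hy => simp only [map_mul, hx, hy]
    | of j y =>
    have hj := j.isLt
    rw [← factor_eq_of hj]
    rw [killLast_factor _ hj]
    by_cases h1 : j.val = k.val
    · rw [h1, rep_sigma_lo h (by omega), rep_sigma_lo h hk, map_mul, map_mul, map_inv,
        killLast_factor _ (by omega), killLast_factor _ (by omega)]
    by_cases h2 : j.val = k.val + 1
    · rw [h2, rep_sigma_hi h (by omega), rep_sigma_hi h hk, map_mul, map_mul, map_inv,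
        killLast_factor _ (by omega), killLast_factor _ (by omega)]
    · rw [rep_sigma_of_ne h (by omega) h1 h2, rep_sigma_of_ne h hk h1 h2,
        killLast_factor _ (by omega)]
  have hb : b ∈ Subgroup.closure (Set.range (PresentedGroup.of (rels := braidRelators (N + 1)))) :=
    by rw [PresentedGroup.closure_range_of]; trivial
  induction hb using Subgroup.closure_induction generalizing g with
  | mem x hx => obtain ⟨k, rfl⟩ := hx; exact gen k g
  | one => simp
  | mul x y _ _ hx hy => rw [map_mul, map_mul, map_mul, MulAut.mul_apply, MulAut.mul_apply, hx, hy]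
  | inv x _ hx =>
    have := hx ((artinTypeRep (N + 2) h (addStrand N x))⁻¹ g)
    rw [MulAut.apply_inv_self] at this
    rw [map_inv, map_inv, map_inv, this, MulAut.inv_apply_self]

/-- The subgroup generated by the copies of `h`. -/
def copies (n : ℕ) (h : H) : Subgroup (FreePower n H) :=
  Subgroup.closure {x | ∃ j < n, x = factor n j H h}

lemma factor_mem_copies (h : H) {j : ℕ} (hj : j < n) : factor n j H h ∈ copies n h :=
  Subgroup.subset_closure ⟨j, hj, rfl⟩

/-- Modulo the last factor, a push conjugates factor `k` by `h_k^m`, which fixes `h_k` but not the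
whole factor, and acts trivially on the other factors. This is why the induction follows only the
copies of `h`. -/
lemma IsPush.copies {h : H} {k : ℕ} (hk : k ≤ N) {m : ℤ} {f : MulAut (FreePower (N + 2) H)}
    (hf : IsPush h N k m f) {g : FreePower (N + 2) H} (hg : g ∈ copies (N + 2) h) :
    f g ∈ ArtinType.copies (N + 2) h ∧ killLast N H (f g) = killLast N H g := by
  have ha := factor_mem_copies h (show k < N + 2 by omega)
  have hz := factor_mem_copies h (show N + 1 < N + 2 by omega)
  have ka := killLast_factor (N := N) k (by omega) h
  have kz := killLast_factor (N := N) (N + 1) (by omega) h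
  rw [factor_last_eq_one] at kz
  induction hg using Subgroup.closure_induction with
  | mem x hx =>
    obtain ⟨j, hj, rfl⟩ := hx
    have hP := zpow_mem (mul_mem hz ha) (-m)
    have hQ := zpow_mem (mul_mem ha hz) m
    have hx := factor_mem_copies h hj
    obtain h1 | rfl | h1 | rfl : j < k ∨ j = k ∨ (k < j ∧ j ≤ N) ∨ j = N + 1 := by omega
    · rw [hf.lt j h1]
      exact ⟨hx, rfl⟩
    · rw [hf.map_self, MulAut.conj_apply]
      refine ⟨mul_mem (mul_mem hP hx) (inv_mem hP), ?_⟩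
      simp only [map_mul, map_inv, map_zpow, ka, kz]
      group
    · rw [hf.gt j h1.1 h1.2, MulAut.conj_apply]
      refine ⟨mul_mem (mul_mem (mul_mem hP hQ) hx) (inv_mem (mul_mem hP hQ)), ?_⟩
      simp only [map_mul, map_inv, map_zpow, ka, kz]
      group
    · rw [hf.map_last, MulAut.conj_apply]
      refine ⟨mul_mem (mul_mem hP hx) (inv_mem hP), ?_⟩
      simp only [map_mul, map_inv, map_zpow, ka, kz]
      group
  | one => rw [map_one]; exact ⟨one_mem _, rfl⟩
  | mul x y _ _ hx hy =>
    rw [map_mul, map_mul, map_mul, hx.2, hy.2]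
    exact ⟨mul_mem hx.1 hy.1, rfl⟩
  | inv x _ hx =>
    rw [map_inv, map_inv, map_inv, hx.2]
    exact ⟨inv_mem hx.1, rfl⟩

lemma killLast_strandPushes {h : H} {x : BraidGroup (N + 2)}
    (hx : x ∈ strandPushes (sigma (N + 2)) N) {g : FreePower (N + 2) H}
    (hg : g ∈ copies (N + 2) h) :
    artinTypeRep (N + 2) h x g ∈ copies (N + 2) h ∧
      killLast N H (artinTypeRep (N + 2) h x g) = killLast N H g := by
  induction hx using Subgroup.closure_induction_left with
  | one => simpa using hg
  | mul_left a ha y hy ih =>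
    obtain ⟨k, hk, rfl⟩ := ha
    have := (isPush_strandPush h hk).copies hk ih.1
    rw [map_mul, MulAut.mul_apply]
    exact ⟨this.1, this.2.trans ih.2⟩
  | inv_mul_cancel a ha y hy ih =>
    obtain ⟨k, hk, rfl⟩ := ha
    have := (isPush_strandPush h hk).inv.copies hk ih.1
    rw [map_mul, map_inv, MulAut.mul_apply]
    exact ⟨this.1, this.2.trans ih.2⟩

/-- The braids that send the last copy of `h` to one of its conjugates. -/
def lastStabilizer (N : ℕ) (h : H) : Subgroup (BraidGroup (N + 2)) where
  carrier := {x | IsConj (factor (N + 2) (N + 1) H h)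
    (artinTypeRep (N + 2) h x (factor (N + 2) (N + 1) H h))}
  one_mem' := by simpa only [Set.mem_ofPred_eq, map_one, MulAut.one_apply] using IsConj.refl _
  mul_mem' {x y} hx hy := by
    have := (artinTypeRep (N + 2) h x).toMonoidHom.map_isConj hy
    simp only [Set.mem_ofPred_eq, map_mul, MulAut.mul_apply]
    exact hx.trans this
  inv_mem' {x} hx := by
    have := (artinTypeRep (N + 2) h x)⁻¹.toMonoidHom.map_isConj hx
    simp only [Set.mem_ofPred_eq, map_inv]
    have e := MulAut.inv_apply_self _ (artinTypeRep (N + 2) h x) (factor (N + 2) (N + 1) H h)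
    exact (e ▸ this).symm

lemma strandPushes_le_lastStabilizer (h : H) :
    strandPushes (sigma (N + 2)) N ≤ lastStabilizer N h := by
  refine (Subgroup.closure_le _).2 ?_
  rintro _ ⟨k, hk, rfl⟩
  exact isConj_iff.2 ⟨_, ((isPush_strandPush h hk).map_last.trans (MulAut.conj_apply _ _)).symm⟩

lemma initialBraids_le_lastStabilizer (h : H) :
    initialBraids (sigma (N + 2)) N ≤ lastStabilizer N h := by
  refine (Subgroup.closure_le _).2 ?_
  rintro _ ⟨j, hj, rfl⟩
  change IsConj _ _
  rw [rep_sigma_of_ne h hj.le (by omega) (by omega)]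

/-- Only `σ_N`, which acts last, moves `h_{N+1}`, and it sends it to `h_N`. The two are not
conjugate, since killing the last factor trivializes only the former. -/
lemma strandCycle_notMem_lastStabilizer {h : H} (hh : h ≠ 1) {j : ℕ} (hj : j ≤ N) :
    strandCycle (sigma (N + 2)) N j ∉ lastStabilizer N h := by
  have e : artinTypeRep (N + 2) h (strandCycle (sigma (N + 2)) N j)
      (factor (N + 2) (N + 1) H h) = factor (N + 2) N H h := by
    induction hj using Nat.decreasingInduction with
    | self =>
      rw [strandCycle_of_le _ le_rfl, strandCycle_top, one_mul, rep_sigma_hi h le_rfl]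
      group
    | of_succ j hj ih =>
      rw [strandCycle_of_le _ hj.le, map_mul, MulAut.mul_apply,
        rep_sigma_of_ne h hj.le (by omega) (by omega), ih]
  intro hmem
  change IsConj _ _ at hmem
  rw [e] at hmem
  have := (killLast N H).map_isConj hmem
  rw [killLast_factor _ (by omega), killLast_factor _ (by omega), factor_last_eq_one,
    isConj_one_right, factor_eq_of (by omega)] at this
  exact hh (of_injective (M := fun _ : Fin (N + 1) => H) _ (this.trans (map_one _).symm))

lemma subsingleton_braidGroup (hn : n ≤ 1) : Subsingleton (BraidGroup n) := by
  have : IsEmpty (Fin (n - 1)) := by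
    rw [show n - 1 = 0 by omega]
    infer_instance
  refine ⟨fun x y => ?_⟩
  obtain ⟨x, rfl⟩ := PresentedGroup.mk_surjective _ x
  obtain ⟨y, rfl⟩ := PresentedGroup.mk_surjective _ y
  rw [Subsingleton.elim x y]

/-- A braid that fixes every copy of `h` is trivial. -/
lemma eq_one_of_fixes {h : H} (hh : h ≠ 1) (n : ℕ) (x : BraidGroup n)
    (hx : ∀ j < n, artinTypeRep n h x (factor n j H h) = factor n j H h) : x = 1 := by
  induction n with
  | zero => exact (subsingleton_braidGroup (by omega)).elim _ _
  | succ n ih =>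
    cases n with
    | zero => exact (subsingleton_braidGroup (by omega)).elim _ _
    | succ N =>
      obtain ⟨f, hf, b, hb, j, hj, rfl⟩ := (sigma_relations N).exists_decomposition
        (closure_sigma N x)
      have hfb := mul_mem (strandPushes_le_lastStabilizer h hf)
        (initialBraids_le_lastStabilizer h hb)
      -- The whole product and `f * b` lie in `lastStabilizer`, hence so does the cycle.
      obtain rfl : j = N + 1 := by
        by_contra hne
        refine strandCycle_notMem_lastStabilizer hh (show j ≤ N by omega)
          ((Subgroup.mul_mem_cancel_left _ hfb).1 ?_)
        change IsConj _ _
        rw [hx _ (by omega)]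
      rw [strandCycle_top, mul_one] at hx ⊢
      obtain ⟨b, rfl⟩ := initialBraids_le_range hb
      obtain rfl : b = 1 := by
        refine ih b fun j hj => ?_
        -- On the copies of `h`, `b` acts as `f⁻¹`, which becomes invisible once the last factor is
        -- killed.
        have e : artinTypeRep (N + 2) h (addStrand N b) (factor (N + 2) j H h) =
            artinTypeRep (N + 2) h f⁻¹ (factor (N + 2) j H h) := by
          have := hx j (by omega)
          rw [map_mul, MulAut.mul_apply] at this
          nth_rw 2 [← this]
          rw [map_inv, MulAut.inv_apply_self]
        have := congrArg (killLast N H) e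
        rw [killLast_rep_addStrand, killLast_factor _ (by omega),
          (killLast_strandPushes (inv_mem hf) (factor_mem_copies h (by omega))).2,
          killLast_factor _ (by omega)] at this
        exact this
      rw [map_one, mul_one] at hx ⊢
      exact eq_one_of_mem_strandPushes hh hf (hx _ (by omega))

end ArtinType

/-- For every group `H`, every non-trivial `h : H` and every `n`, the Artin type representation of
the braid group on `n` strands associated to `(H, h)` is faithful. -/
theorem proposition4p1 (n : ℕ) {H : Type*} [Group H] (h : H) (hh : h ≠ 1) :
    Function.Injective (artinTypeRep n h) := by
  rw [injective_iff_map_eq_one]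
  intro x hx
  exact ArtinType.eq_one_of_fixes hh n x fun j _ => by rw [hx, MulAut.one_apply]
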